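/- Let $\beta\mathbb{Z}[i]$ be the set of ultrafilters on $\mathbb{Z}[i]$, with the addition $A\in p+q\iff\{x:\{y: x+y\in A\}\in q\}\in p$, and let $K(\beta\mathbb{Z}[i])$ be its smallest two-sided ideal; an idempotent of $\beta\mathbb{Z}[i]$ is an ultrafilter $p$ with $p+p=p$. For a set $A\subseteq\mathbb{Z}[i]$ put $\overline{A}=\{p\in\beta\mathbb{Z}[i]: A\in p\}$. The set $A$ is a *$J$-set* if for every finite nonempty set $F$ of sequences in $\mathbb{Z}[i]$ there are $a\in\mathbb{Z}[i]$ and a finite nonempty $H\subseteq\mathbb{N}$ with $a+\sum_{t\in H}f(t)\in A$ for all $f\in F$; let $J(\mathbb{Z}[i])$ be the set of ultrafilters all of whose members are $J$-sets. The set $A$ is *central\** if it belongs to every idempotent in $K(\beta\mathbb{Z}[i])$, and is a *$C^*$-set* if it belongs to every idempotent in $J(\mathbb{Z}[i])$. For a sequence $\langle x_n\rangle_{n=1}^\infty$ in $\mathbb{Z}[i]$ let $FS(\langle x_n\rangle_{n=m}^\infty)$ be the set of all sums $\sum_{n\in F}x_n$, where $F$ is a finite nonempty set of integers $n\ge m$,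 and let $FP(\langle x_n\rangle_{n=1}^\infty)$ be the set of all products $\prod_{n\in F}x_n$, where $F\subseteq\mathbb{N}$ is finite and nonempty. The sequence is *minimal* if $\bigcap_{m=1}^\infty\overline{FS(\langle x_n\rangle_{n=m}^\infty)}\cap K(\beta\mathbb{Z}[i])\neq\emptyset$, and *almost minimal* if $\bigcap_{m=1}^\infty\overline{FS(\langle x_n\rangle_{n=m}^\infty)}\cap J(\mathbb{Z}[i])\neq\emptyset$. A sequence $\langle y_n\rangle_{n=1}^\infty$ is a *sum subsystem* of $\langle x_n\rangle_{n=1}^\infty$ if there are finite nonempty sets $H_n\subseteq\mathbb{N}$ with $\max H_n<\min H_{n+1}$ and $y_n=\sum_{t\in H_n}x_t$ for every $n$. **Theorem.** (a) If $\langle x_n\rangle_{n=1}^\infty$ is a minimal sequence in $\mathbb{Z}[i]$ and $A\subseteq\mathbb{Z}[i]$ is a central\* set, then there is a sum subsystem $\langle y_n\rangle_{n=1}^\infty$ of $\langle x_n\rangle_{n=1}^\infty$ such that $FS(\langle y_n\rangle_{n=1}^\infty)\cup FP(\langle y_n\rangle_{n=1}^\infty)\subseteq A$. (b) If $\langle x_n\rangle_{n=1}^\infty$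 is an almost minimal sequence in $\mathbb{Z}[i]$ and $A\subseteq\mathbb{Z}[i]$ is a $C^*$-set, then there is a sum subsystem $\langle y_n\rangle_{n=1}^\infty$ of $\langle x_n\rangle_{n=1}^\infty$ such that $FS(\langle y_n\rangle_{n=1}^\infty)\cup FP(\langle y_n\rangle_{n=1}^\infty)\subseteq A$. -/

import Mathlib

namespace BetaAlgebra

/-- A two-sided ideal of an additively written semigroup: a nonempty subset `I` with
`T + I ⊆ I` and `I + T ⊆ I`. -/
def IsIdeal {T : Type*} [Add T] (I : Set T) : Prop :=
  I.Nonempty ∧ ∀ t, ∀ x ∈ I, t + x ∈ I ∧ x + t ∈ I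

/-- `K(T)`, the smallest two-sided ideal, as the intersection of all two-sided ideals. -/
def smallestIdeal (T : Type*) [Add T] : Set T :=
  ⋂₀ {I : Set T | IsIdeal I}

section Defs

-- `βS` is `Ultrafilter S`, with Mathlib's extension of `+` from `S` to `βS`.
attribute [local instance] Ultrafilter.add

/-- The extended addition: `A ∈ p + q ↔ {x | -x + A ∈ q} ∈ p`, where
`-x + A = {y | x + y ∈ A}`. -/
theorem mem_add_iff {S : Type*} [Add S] (p q : Ultrafilter S) (A : Set S) :
    A ∈ p + q ↔ {x : S | {y : S | x + y ∈ A} ∈ q} ∈ p :=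
  Iff.rfl

/-- `p` is an idempotent of `(βS, +)`. -/
def IsIdempotent {S : Type*} [Add S] (p : Ultrafilter S) : Prop :=
  p + p = p

/-- `K(βS)`. -/
def betaK (S : Type*) [Add S] : Set (Ultrafilter S) :=
  smallestIdeal (Ultrafilter S)

end Defs

/-- A set is central* if it belongs to every minimal idempotent of `βS`, that is, to every
idempotent in `K(βS)`. -/
def IsCentralStar {S : Type*} [Add S] (A : Set S) : Prop :=
  ∀ p : Ultrafilter S, p ∈ betaK S → IsIdempotent p → A ∈ p

/-- `FS(⟨x_n⟩_{n ≥ m})`: the sums of `x` over finite nonempty sets of indices `≥ m`. -/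
def FSFrom {S : Type*} [AddCommMonoid S] (x : ℕ → S) (m : ℕ) : Set S :=
  {s | ∃ F : Finset ℕ, F.Nonempty ∧ (∀ n ∈ F, m ≤ n) ∧ s = ∑ n ∈ F, x n}

/-- The finite sums of the sequence `x` (indexed from `0`). -/
def FS {S : Type*} [AddCommMonoid S] (x : ℕ → S) : Set S :=
  {s | ∃ F : Finset ℕ, F.Nonempty ∧ s = ∑ n ∈ F, x n}

/-- The finite products of the sequence `x`. -/
def FP {S : Type*} [CommMonoid S] (x : ℕ → S) : Set S :=
  {s | ∃ F : Finset ℕ, F.Nonempty ∧ s = ∏ n ∈ F, x n}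

/-- `y` is a sum subsystem of `x`: there are finite nonempty `H n` with
`max (H n) < min (H (n + 1))` and `y n = ∑ t ∈ H n, x t`. -/
def IsSumSubsystem {S : Type*} [AddCommMonoid S] (y x : ℕ → S) : Prop :=
  ∃ H : ℕ → Finset ℕ, (∀ n, (H n).Nonempty) ∧
    (∀ n, ∀ i ∈ H n, ∀ j ∈ H (n + 1), i < j) ∧
    ∀ n, y n = ∑ t ∈ H n, x t

/-- `⋂ₘ cl(FS(⟨x_n⟩_{n ≥ m}))` in `βS`, where `cl(A) = {p | A ∈ p}`. -/
def tailClosure {S : Type*} [AddCommMonoid S] (x : ℕ → S) : Set (Ultrafilter S) :=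
  ⋂ m : ℕ, {p : Ultrafilter S | FSFrom x m ∈ p}

/-- `x` is a minimal sequence. -/
def IsMinimalSeq {S : Type*} [AddCommMonoid S] (x : ℕ → S) : Prop :=
  (tailClosure x ∩ betaK S).Nonempty

/-- `A` is a `J`-set. -/
def IsJSet {S : Type*} [AddCommMonoid S] (A : Set S) : Prop :=
  ∀ F : Finset (ℕ → S), F.Nonempty →
    ∃ a : S, ∃ H : Finset ℕ, H.Nonempty ∧ ∀ f ∈ F, a + ∑ t ∈ H, f t ∈ A

/-- `J(S)`, the set of ultrafilters all of whose members are `J`-sets. -/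
def betaJ (S : Type*) [AddCommMonoid S] : Set (Ultrafilter S) :=
  {p | ∀ A ∈ p, IsJSet A}

/-- `A` is a `C*`-set: it belongs to every idempotent in `J(S)`. -/
def IsCStar {S : Type*} [AddCommMonoid S] (A : Set S) : Prop :=
  ∀ p : Ultrafilter S, p ∈ betaJ S → IsIdempotent p → A ∈ p

/-- `x` is an almost minimal sequence. -/
def IsAlmostMinimalSeq {S : Type*} [AddCommMonoid S] (x : ℕ → S) : Prop :=
  (tailClosure x ∩ betaJ S).Nonempty

end BetaAlgebra

namespace BetaAlgebra

attribute [local instance] Ultrafilter.add Ultrafilter.addSemigroup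

section Products

/-- If `y n ∈ B n` and `B (n + 1) ⊆ B n ∩ (y n)⁻¹ B n` for every `n`, then every product of terms
of `y` with indices at least `n` lies in `B n`. -/
@[to_additive]
theorem prod_mem_of_nested {M : Type*} [CommMonoid M] {B : ℕ → Set M} {y : ℕ → M}
    (mem : ∀ n, y n ∈ B n) (anti : ∀ n, B (n + 1) ⊆ B n)
    (step : ∀ n, ∀ z ∈ B (n + 1), y n * z ∈ B n) (F : Finset ℕ) (hF : F.Nonempty) :
    ∀ n, (∀ i ∈ F, n ≤ i) → ∏ i ∈ F, y i ∈ B n := by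
  induction F using Finset.strongInduction with
  | H F ih =>
    intro n hn
    set k := F.min' hF with hk
    have hkF : k ∈ F := F.min'_mem hF
    refine antitone_nat_of_succ_le anti (hn k hkF) ?_
    rw [← Finset.mul_prod_erase F y hkF]
    rcases (F.erase k).eq_empty_or_nonempty with h | h
    · simpa [h] using mem k
    · refine step k _ (ih _ (Finset.erase_ssubset hkF) h (k + 1) fun i hi => ?_)
      have h1 := Finset.mem_erase.1 hi
      have h2 : k ≤ i := F.min'_le i h1.2
      have h3 := h1.1
      omega

end Products

section Ultrafilters

theorem add_mem_smallestIdeal {T : Type*} [Add T] {p : T} (hp : p ∈ smallestIdeal T) (q : T) :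
    q + p ∈ smallestIdeal T := fun I hI => (hI.2 q p (hp I hI)).1

variable {S : Type*} [AddCommMonoid S]

theorem isClosed_tailClosure (x : ℕ → S) : IsClosed (tailClosure x) :=
  isClosed_iInter fun _ => ultrafilter_isClosed_basic _

theorem add_mem_tailClosure {x : ℕ → S} {p q : Ultrafilter S} (hp : p ∈ tailClosure x)
    (hq : q ∈ tailClosure x) : p + q ∈ tailClosure x := by
  simp only [tailClosure, Set.mem_iInter] at hp hq ⊢
  intro m
  refine (mem_add_iff p q _).2 (Filter.mem_of_superset (hp m) ?_)
  rintro _ ⟨F, hF, hFm, rfl⟩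
  refine Filter.mem_of_superset (hq (F.max' hF + 1)) ?_
  rintro _ ⟨G, hG, hGm, rfl⟩
  have lt : ∀ i ∈ F, ∀ j ∈ G, i < j := fun i hi j hj =>
    (Nat.lt_succ_of_le (F.le_max' i hi)).trans_le (hGm j hj)
  have disj : Disjoint F G := Finset.disjoint_left.2 fun i hi hj => (lt i hi i hj).false
  refine ⟨F ∪ G, hF.mono Finset.subset_union_left, fun n hn => ?_,
    (Finset.sum_union disj).symm⟩
  rcases Finset.mem_union.1 hn with h | h
  · exact hFm n h
  · obtain ⟨i, hi⟩ := hF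
    exact (hFm i hi).trans (lt i hi n h).le

theorem isClosed_betaJ : IsClosed (betaJ S) := by
  have : betaJ S = ⋂ A ∈ {A : Set S | ¬ IsJSet A}, {p : Ultrafilter S | A ∈ p}ᶜ := by
    ext p
    simp only [betaJ, Set.mem_iInter, Set.mem_compl_iff, Set.mem_ofPred_eq]
    exact forall_congr' fun A => ⟨fun h hA hp => hA (h hp), fun h hp => by_contra fun hA => h hA hp⟩
  rw [this]
  exact isClosed_biInter fun A _ => (ultrafilter_isOpen_basic A).isClosed_compl

theorem add_mem_betaJ {p : Ultrafilter S} (hp : p ∈ betaJ S) (q : Ultrafilter S) :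
    p + q ∈ betaJ S := by
  intro A hA F hF
  obtain ⟨a, H, hH, h⟩ := hp _ ((mem_add_iff p q A).1 hA) F hF
  have : (⋂ f ∈ F, {y | a + ∑ t ∈ H, f t + y ∈ A}) ∈ q :=
    (Filter.biInter_finset_mem F).2 h
  obtain ⟨y, hy⟩ := q.nonempty_of_mem this
  refine ⟨a + y, H, hH, fun f hf => ?_⟩
  have := Set.mem_iInter₂.1 hy f hf
  rwa [Set.mem_ofPred_eq, add_right_comm] at this

theorem exists_idempotent_mem_betaK {x : ℕ → S} (hx : IsMinimalSeq x) :
    ∃ p ∈ tailClosure x, p ∈ betaK S ∧ IsIdempotent p := by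
  obtain ⟨p, hpT, hpK⟩ := hx
  have zero_add' : pure 0 + p = p := by
    ext A
    rw [mem_add_iff]
    simp
  obtain ⟨e, ⟨heT, q, rfl⟩, he⟩ := exists_idempotent_in_compact_add_subsemigroup
    (Ultrafilter.continuous_add_left (M := S)) (tailClosure x ∩ Set.range (· + p))
    ⟨p, hpT, pure 0, zero_add'⟩
    ((isClosed_tailClosure x).inter
      (isCompact_range (Ultrafilter.continuous_add_left p)).isClosed).isCompact
    (by
      rintro _ ⟨hu, u, rfl⟩ _ ⟨hv, v, rfl⟩
      exact ⟨add_mem_tailClosure hu hv, u + p + v, add_assoc _ _ _⟩)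
  exact ⟨_, heT, add_mem_smallestIdeal hpK q, he⟩

theorem exists_idempotent_mem_betaJ {x : ℕ → S} (hx : IsAlmostMinimalSeq x) :
    ∃ p ∈ tailClosure x, p ∈ betaJ S ∧ IsIdempotent p := by
  obtain ⟨e, ⟨heT, heJ⟩, he⟩ := exists_idempotent_in_compact_add_subsemigroup
    (Ultrafilter.continuous_add_left (M := S)) (tailClosure x ∩ betaJ S) hx
    ((isClosed_tailClosure x).inter isClosed_betaJ).isCompact
    fun u hu v hv => ⟨add_mem_tailClosure hu.1 hv.1, add_mem_betaJ hu.2 v⟩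
  exact ⟨e, heT, heJ, he⟩

end Ultrafilters

section Rings

variable {R : Type*} [CommRing R]

/-- Dilation by a ring element respects the addition of ultrafilters. -/
theorem map_mul_left_add (s : R) (p q : Ultrafilter R) :
    (p + q).map (s * ·) = p.map (s * ·) + q.map (s * ·) := by
  ext A
  have h : ∀ x y, x + y ∈ (s * ·) ⁻¹' A ↔ s * x + s * y ∈ A := fun x y => by
    rw [← mul_add]
    rfl
  simp only [mem_add_iff, Ultrafilter.mem_map, h]
  rfl

theorem IsIdempotent.map_mul_left {p : Ultrafilter R} (hp : IsIdempotent p) (s : R) :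
    IsIdempotent (p.map (s * ·)) := by
  rw [IsIdempotent, ← map_mul_left_add, hp]

/-- From an idempotent `p` concentrated on the tails of `x`, all of whose nonzero dilates contain
`A`, one obtains a sum subsystem of `x` with all finite sums and products in `A`. -/
theorem exists_sumSubsystem [IsDomain R] {x : ℕ → R} {A : Set R} {p : Ultrafilter R}
    (hpx : p ∈ tailClosure x) (hp : IsIdempotent p) (hp0 : {0}ᶜ ∈ p)
    (hA : ∀ s : R, s ≠ 0 → (s * ·) ⁻¹' A ∈ p) :
    ∃ y : ℕ → R, IsSumSubsystem y x ∧ FS y ∪ FP y ⊆ A := by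
  let State := {c : Set R × Set R × ℕ // c.1 ∈ p ∧ ∀ s : R, s ≠ 0 → (s * ·) ⁻¹' c.2.1 ∈ p}
  have next : ∀ c : State, ∃ H : Finset ℕ, H.Nonempty ∧ (∀ n ∈ H, c.1.2.2 ≤ n) ∧
      ∑ t ∈ H, x t ∈ c.1.1 ∧ {z | ∑ t ∈ H, x t + z ∈ c.1.1} ∈ p ∧
      ∑ t ∈ H, x t ∈ c.1.2.1 ∧ ∑ t ∈ H, x t ≠ 0 := by
    rintro ⟨⟨B, C, m⟩, hB, hC⟩
    have hB' : {y | {z | y + z ∈ B} ∈ p} ∈ p := by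
      rw [← mem_add_iff, hp]
      exact hB
    have hC' : C ∈ p := by simpa using hC 1 one_ne_zero
    obtain ⟨_, ⟨⟨⟨⟨H, hH, hm, rfl⟩, h1⟩, h2⟩, h3⟩, h4⟩ := p.nonempty_of_mem
      (Filter.inter_mem (Filter.inter_mem (Filter.inter_mem (Filter.inter_mem
        (Set.mem_iInter.1 hpx m) hB) hB') hC') hp0)
    exact ⟨H, hH, hm, h1, h2, h3, h4⟩
  choose H hH hm hB hB' hC h0 using next
  let succ : State → State := fun c =>
    ⟨(c.1.1 ∩ {z | ∑ t ∈ H c, x t + z ∈ c.1.1},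
      c.1.2.1 ∩ ((∑ t ∈ H c, x t) * ·) ⁻¹' c.1.2.1, (H c).max' (hH c) + 1),
      Filter.inter_mem c.2.1 (hB' c), fun s hs => by
        refine Filter.inter_mem (c.2.2 s hs) ?_
        refine Filter.mem_of_superset (c.2.2 _ (mul_ne_zero (h0 c) hs)) fun z hz => ?_
        change (∑ t ∈ H c, x t) * (s * z) ∈ c.1.2.1
        rw [← mul_assoc]
        exact hz⟩
  have hA1 : A ∈ p := by simpa using hA 1 one_ne_zero
  let c : ℕ → State := fun n => succ^[n] ⟨(A, A, 0), hA1, hA⟩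
  have hc : ∀ n, c (n + 1) = succ (c n) := fun n => Function.iterate_succ_apply' succ n _
  refine ⟨fun n => ∑ t ∈ H (c n), x t, ⟨fun n => H (c n), fun n => hH _, fun n i hi j hj => ?_,
    fun n => rfl⟩, Set.union_subset ?_ ?_⟩
  · have h := hm _ j hj
    rw [hc] at h
    exact (Nat.lt_succ_of_le ((H (c n)).le_max' i hi)).trans_le h
  · rintro _ ⟨F, hF, rfl⟩
    refine sum_mem_of_nested (B := fun n => (c n).1.1) (fun n => hB (c n)) (fun n => ?_)
      (fun n z hz => ?_) F hF 0 fun _ _ => Nat.zero_le _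
    · rw [hc]
      exact Set.inter_subset_left
    · rw [hc] at hz
      exact hz.2
  · rintro _ ⟨F, hF, rfl⟩
    refine prod_mem_of_nested (B := fun n => (c n).1.2.1) (fun n => hC (c n)) (fun n => ?_)
      (fun n z hz => ?_) F hF 0 fun _ _ => Nat.zero_le _
    · rw [hc]
      exact Set.inter_subset_left
    · rw [hc] at hz
      exact hz.2

end Rings

section Gaussian

/-- The residue of a Gaussian integer modulo a natural number. -/
def residue (N : ℕ) : GaussianInt →+ ZMod N × ZMod N where
  toFun z := (z.re, z.im)
  map_zero' := by simp
  map_add' := by simp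

theorem dvd_of_residue_eq_zero {s z : GaussianInt} (h : residue s.norm.natAbs z = 0) : s ∣ z := by
  have h' := Prod.ext_iff.1 h
  have hs : ((s.norm : ℤ) : GaussianInt) ∣ z := by
    rw [Zsqrtd.intCast_dvd]
    exact ⟨Int.natAbs_dvd.1 ((ZMod.intCast_zmod_eq_zero_iff_dvd _ _).1 h'.1),
      Int.natAbs_dvd.1 ((ZMod.intCast_zmod_eq_zero_iff_dvd _ _).1 h'.2)⟩
  exact (Dvd.intro _ (Zsqrtd.norm_eq_mul_conj s).symm).trans hs

theorem neZero_natAbs_norm {s : GaussianInt} (hs : s ≠ 0) : NeZero s.norm.natAbs :=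
  ⟨Int.natAbs_ne_zero.2 (GaussianInt.norm_pos.2 hs).ne'⟩

theorem map_mul_left_mem_betaK {s : GaussianInt} (hs : s ≠ 0) {p : Ultrafilter GaussianInt}
    (hp : p ∈ betaK GaussianInt) : p.map (s * ·) ∈ betaK GaussianInt := by
  have := neZero_natAbs_norm hs
  intro I hI
  refine hp {q | q.map (s * ·) ∈ I} ⟨?_, fun t q hq => ?_⟩
  · obtain ⟨q, hq⟩ := hI.1
    obtain ⟨c, hc⟩ := (q.map (residue s.norm.natAbs)).eq_pure_of_finite
    have hcq : residue s.norm.natAbs ⁻¹' {c} ∈ q := by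
      rw [← Ultrafilter.mem_map, hc]
      exact Filter.mem_pure.2 rfl
    obtain ⟨a, ha⟩ := q.nonempty_of_mem hcq
    have range_mem : Set.range (s * ·) ∈ pure (-a) + q := by
      rw [mem_add_iff]
      refine Ultrafilter.mem_pure.2 (Filter.mem_of_superset hcq fun z hz => ?_)
      obtain ⟨w, hw⟩ : s ∣ -a + z := dvd_of_residue_eq_zero <| by
        rw [map_add, map_neg, Set.mem_singleton_iff.1 ha, Set.mem_singleton_iff.1 hz,
          neg_add_cancel]
      exact ⟨w, hw.symm⟩
    refine ⟨(pure (-a) + q).comap (mul_right_injective₀ hs) range_mem, ?_⟩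
    have : ((pure (-a) + q).comap (mul_right_injective₀ hs) range_mem).map (s * ·) =
        pure (-a) + q :=
      Ultrafilter.coe_injective (Filter.map_comap_of_mem range_mem)
    rw [Set.mem_ofPred_eq, this]
    exact (hI.2 _ q hq).1
  · simp only [Set.mem_ofPred_eq, map_mul_left_add]
    exact hI.2 _ _ hq

theorem map_mul_left_mem_betaJ {s : GaussianInt} (hs : s ≠ 0) {p : Ultrafilter GaussianInt}
    (hp : p ∈ betaJ GaussianInt) : p.map (s * ·) ∈ betaJ GaussianInt := by
  classical
  have := neZero_natAbs_norm hs
  set N := s.norm.natAbs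
  intro A hA F hF
  obtain ⟨c, hc⟩ := Finite.exists_infinite_fiber fun (t : ℕ) (f : F) => residue N (f.1 t)
  have hc := Set.infinite_coe_iff.1 hc
  let g : ℕ → ℕ := Nat.nth (· ∈ (fun (t : ℕ) (f : F) => residue N (f.1 t)) ⁻¹' {c})
  have hg : Function.Injective g := Nat.nth_injective hc
  have hgc : ∀ n, ∀ f : F, residue N (f.1 (g n)) = c f := fun n f =>
    congrFun (Nat.nth_mem_of_infinite hc n) f
  let block : ℕ → Finset ℕ := fun n => (Finset.range N).image fun i => g (n * N + i)
  have block_sum : ∀ (f : ℕ → GaussianInt) (n : ℕ),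
      ∑ t ∈ block n, f t = ∑ i ∈ Finset.range N, f (g (n * N + i)) := fun f n =>
    Finset.sum_image fun i _ j _ h => Nat.add_left_cancel (hg h)
  have dvd : ∀ f ∈ F, ∀ n, s ∣ ∑ t ∈ block n, f t := fun f hf n => by
    apply dvd_of_residue_eq_zero
    rw [block_sum, map_sum, Finset.sum_congr rfl fun i _ => hgc _ ⟨f, hf⟩, Finset.sum_const,
      Finset.card_range]
    ext <;> simp
  choose! q hq using dvd
  obtain ⟨a, H, hH, h⟩ := hp _ (Ultrafilter.mem_map.1 hA) (F.image q) (hF.image q)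
  have disj : (H : Set ℕ).PairwiseDisjoint block := fun m _ n _ hmn =>
    Finset.disjoint_left.2 fun t ht ht' => by
      obtain ⟨i, hi, rfl⟩ := Finset.mem_image.1 ht
      obtain ⟨j, hj, hij⟩ := Finset.mem_image.1 ht'
      have key := congrArg (· / N) (hg hij)
      have pos : 0 < N := NeZero.pos N
      simp only [mul_comm _ N, Nat.mul_add_div pos, Nat.div_eq_of_lt (Finset.mem_range.1 hi),
        Nat.div_eq_of_lt (Finset.mem_range.1 hj), add_zero] at key
      exact hmn key.symm
  refine ⟨s * a, H.biUnion block, hH.biUnion fun n _ =>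
    (Finset.nonempty_range_iff.2 (NeZero.ne N)).image _, fun f hf => ?_⟩
  rw [Finset.sum_biUnion disj, Finset.sum_congr rfl fun n _ => hq f hf n, ← Finset.mul_sum,
    ← mul_add]
  exact h (q f) (Finset.mem_image_of_mem q hf)

theorem compl_zero_mem_of_mem_betaJ {p : Ultrafilter GaussianInt} (hp : p ∈ betaJ GaussianInt) :
    {0}ᶜ ∈ p := by
  classical
  refine Ultrafilter.compl_mem_iff_notMem.2 fun h0 => ?_
  obtain ⟨a, H, hH, h⟩ := hp _ h0 {0, 1} (Finset.insert_nonempty _ _)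
  have h1 : a = 0 := by simpa using h 0 (by simp)
  have h2 : a + (H.card : GaussianInt) = 0 := by simpa using h 1 (by simp)
  rw [h1, zero_add, Nat.cast_eq_zero] at h2
  exact hH.card_pos.ne' h2

theorem compl_zero_mem_of_mem_betaK {p : Ultrafilter GaussianInt} (hp : p ∈ betaK GaussianInt) :
    {0}ᶜ ∈ p := by
  refine (hp {q | ∀ a, {a}ᶜ ∈ q} ⟨?_, fun t q hq => ⟨fun a => ?_, fun a => ?_⟩⟩) 0
  · exact ⟨Filter.hyperfilter _, fun a => (Set.finite_singleton a).compl_mem_hyperfilter⟩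
  · rw [mem_add_iff]
    refine Filter.univ_mem' fun y => Filter.mem_of_superset (hq (a - y)) fun z hz h => hz ?_
    exact eq_sub_of_add_eq' h
  · rw [mem_add_iff]
    by_cases h : ∃ b, {z | b + z = a} ∈ t
    · obtain ⟨b, hb⟩ := h
      refine Filter.mem_of_superset (hq b) fun y hy => Filter.mem_of_superset hb fun z hz h => hy ?_
      exact add_right_cancel ((Set.mem_singleton_iff.1 h).trans (Eq.symm hz))
    · refine Filter.univ_mem' fun y => Ultrafilter.compl_mem_iff_notMem.2 fun hy => h ⟨y, hy⟩

end Gaussian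

end BetaAlgebra

theorem theorem2p20 :
    (∀ (x : ℕ → GaussianInt) (A : Set GaussianInt),
      BetaAlgebra.IsMinimalSeq x → BetaAlgebra.IsCentralStar A →
        ∃ y : ℕ → GaussianInt, BetaAlgebra.IsSumSubsystem y x ∧
          BetaAlgebra.FS y ∪ BetaAlgebra.FP y ⊆ A) ∧
    (∀ (x : ℕ → GaussianInt) (A : Set GaussianInt),
      BetaAlgebra.IsAlmostMinimalSeq x → BetaAlgebra.IsCStar A →
        ∃ y : ℕ → GaussianInt, BetaAlgebra.IsSumSubsystem y x ∧
          BetaAlgebra.FS y ∪ BetaAlgebra.FP y ⊆ A) := by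
  constructor
  · intro x A hx hA
    obtain ⟨p, hpx, hpK, hp⟩ := BetaAlgebra.exists_idempotent_mem_betaK hx
    exact BetaAlgebra.exists_sumSubsystem hpx hp (BetaAlgebra.compl_zero_mem_of_mem_betaK hpK)
      fun s hs => hA _ (BetaAlgebra.map_mul_left_mem_betaK hs hpK) (hp.map_mul_left s)
  · intro x A hx hA
    obtain ⟨p, hpx, hpJ, hp⟩ := BetaAlgebra.exists_idempotent_mem_betaJ hx
    exact BetaAlgebra.exists_sumSubsystem hpx hp (BetaAlgebra.compl_zero_mem_of_mem_betaJ hpJ)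
      fun s hs => hA _ (BetaAlgebra.map_mul_left_mem_betaJ hs hpJ) (hp.map_mul_left s)
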